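/- Let $L\ge 2$ and $M\ge 1$ be integers and let $f_i(x)=x/L+t_i$ $(0\le i\le M-1)$ with $t_i\in\mathbb N$, $0=t_0\le t_1\le\dots\le t_{M-1}$ and $(L-1)\mid t_{M-1}$ (repetitions are allowed). Write $[k]=\{0,\dots,k-1\}$, $f_{\mathbf i}=f_{i_1}\circ\dots\circ f_{i_n}$ for $\mathbf i=i_1\cdots i_n$, and $I=\left[0,\tfrac{L\,t_{M-1}}{L-1}\right]$. Let $0<p<1$. To every node $\mathbf i$ of the $M$-ary tree of finite words over $[M]$ (including the empty word) and every $k\in[M]$ attach a coin showing head with probability $p$, all coins being independent. A word $i_1\cdots i_n$ is retained if for every $1\le k\le n$ the coin of the node $i_1\cdots i_{k-1}$ for $i_k$ shows head; let $\mathcal E_n$ be the set of retained words of length $n$. The coin tossing integer self-similar set is $\Lambda_{\mathcal F}(p)=\bigcap_{n\ge1}\bigcup_{\mathbf i\in\mathcal E_n}f_{\mathbf i}(I)$. Non-extinction is the event that there is an infinite word over $[M]$ all of whose finite prefixes are retained. Let $S_0,\dots,S_{m-1}$ be the distinct maps among the $f_i$, let $n_j=\#\{i\in[M]: f_i=S_j\}$,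 and let $\nu$ be the law of $\lim_{n}S_{x_1}\circ\dots\circ S_{x_n}(0)$, where $x_1,x_2,\dots$ are independent with $\Pr(x_k=j)=n_j/M$. Let $J^0,\dots,J^{N-1}$ be, in increasing order, those of the intervals $[(i-1)L,\,iL]$ $(i\in\mathbb Z)$ that have positive $\nu$-measure, and for $a\in[L]$ let $J^k_a$ be the $a$-th from the left (counting from $0$) of the $L$ intervals of length $1$ into which $J^k$ is divided by the integers. For $a\in[L]$ let $A_a$ be the $N\times N$ matrix with $A_a(\ell,k)=n_i$ if $S_i(J^k)=J^\ell_a$ for some (necessarily unique) $i$, and $A_a(\ell,k)=0$ otherwise. Put $CS_{a,U}=\sum_{\ell\in[N]}A_a(\ell,U)$, and $A_{\underline b}=A_{b_1}\cdots A_{b_n}$ for a finite word $\underline b=b_1\cdots b_n$ over $[L]$. **Theorem.** Suppose that 1. $p\cdot CS_{a,U}>1$ for all $a\in[L]$ and $U\in[N]$, and 2. there are a finite word $\underline b$ over $[L]$ and $U\in[N]$ such that $A_{\underline b}(U,V)>0$ for all $V\in[N]$. Then non-extinction has positive probability and, conditioned on non-extinction, almost surely $\Lambda_{\mathcal F}(p)$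 contains an interval of positive length. -/

import Mathlib

open MeasureTheory ProbabilityTheory Filter

/-- An integer self-similar iterated function system on the line: the maps
`f_i x = x / L + t_i`, `i = 0, …, M - 1`, with `2 ≤ L`, natural translations
`0 = t_0 ≤ t_1 ≤ … ≤ t_{M-1}` and `L - 1 ∣ t_{M-1}`. Repetitions among the maps are allowed. -/
structure IntegerIFS where
  /-- the reciprocal of the common contraction ratio -/
  L : ℕ
  /-- the number of maps, counted with repetitions -/
  M : ℕ
  /-- the translations -/
  t : Fin M → ℕ
  two_le_L : 2 ≤ L
  M_pos : 0 < M
  t_zero : t ⟨0, M_pos⟩ = 0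
  t_mono : Monotone t
  dvd_t_last : L - 1 ∣ t ⟨M - 1, Nat.sub_lt M_pos Nat.one_pos⟩

/-- The composition `g_{w_1} ∘ ⋯ ∘ g_{w_n}` along a finite word `w = w_1 ⋯ w_n`. -/
def wordMap {α : Type*} (g : α → ℝ → ℝ) (w : List α) (x : ℝ) : ℝ :=
  w.foldr g x

namespace IntegerIFS

variable (F : IntegerIFS)

/-- The maps `f_i x = x / L + t_i` of the system. -/
noncomputable def f (i : Fin F.M) (x : ℝ) : ℝ := x / F.L + F.t i

/-- The largest translation `t_{M-1}`. -/
def tLast : ℕ := F.t ⟨F.M - 1, Nat.sub_lt F.M_pos Nat.one_pos⟩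

/-- The interval `I = [0, L t_{M-1} / (L - 1)]` spanned by the attractor. -/
noncomputable def I : Set ℝ := Set.Icc 0 ((F.L : ℝ) * F.tLast / ((F.L : ℝ) - 1))

/-! ### The distinct maps and the natural measure -/

/-- The set of the distinct translations. -/
def transSet : Finset ℕ := Finset.univ.image F.t

/-- The number of distinct maps. -/
def m : ℕ := F.transSet.card

/-- The distinct translations in increasing order. -/
def τ (j : Fin F.m) : ℕ := F.transSet.orderEmbOfFin rfl j

/-- The distinct maps `S_j x = x / L + τ_j`. -/
noncomputable def S (j : Fin F.m) (x : ℝ) : ℝ := x / F.L + F.τ j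

/-- `n_j` is the number of `i` with `f_i = S_j`, that is, with `t_i = τ_j`. -/
def n (j : Fin F.m) : ℕ := (Finset.univ.filter fun i : Fin F.M => F.t i = F.τ j).card

lemma τ_mem (j : Fin F.m) : F.τ j ∈ F.transSet := Finset.orderEmbOfFin_mem _ _ _

lemma τ_le (j : Fin F.m) : F.τ j ≤ F.tLast := by
  obtain ⟨i, -, hi⟩ := Finset.mem_image.1 (F.τ_mem j)
  rw [← hi]
  exact F.t_mono (Fin.mk_le_mk.2 (by omega) : i ≤ ⟨F.M - 1, _⟩)

lemma existsUnique_τ (i : Fin F.M) : ∃! j, F.τ j = F.t i := by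
  have h : F.t i ∈ Set.range (F.transSet.orderEmbOfFin rfl) := by
    rw [Finset.range_orderEmbOfFin]
    exact Finset.mem_coe.2 (Finset.mem_image_of_mem _ (Finset.mem_univ i))
  obtain ⟨j, hj⟩ := h
  exact ⟨j, hj, fun j' hj' => (F.transSet.orderEmbOfFin rfl).injective (Eq.trans hj' hj.symm)⟩

lemma sum_n : ∑ j, F.n j = F.M := by
  classical
  have h1 : ∀ j, F.n j = ∑ i : Fin F.M, if F.τ j = F.t i then 1 else 0 := by
    intro j
    rw [n, Finset.card_filter]
    exact Finset.sum_congr rfl fun i _ => by simp only [eq_comm]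
  simp_rw [h1]
  rw [Finset.sum_comm]
  have h2 : ∀ i : Fin F.M, (∑ j, if F.τ j = F.t i then 1 else 0) = 1 := by
    intro i
    obtain ⟨j, hj, hu⟩ := F.existsUnique_τ i
    rw [Finset.sum_eq_single j]
    · simp [hj]
    · intro b _ hb
      exact if_neg fun h => hb (hu b h)
    · simp
  simp [h2]

/-- The probability vector `q = (n_j / M)_j`. -/
noncomputable def q : PMF (Fin F.m) :=
  PMF.ofFintype (fun j => (F.n j : ENNReal) / F.M) (by
    simp_rw [div_eq_mul_inv]
    rw [← Finset.sum_mul, ← Nat.cast_sum, F.sum_n]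
    exact ENNReal.mul_inv_cancel (by exact_mod_cast F.M_pos.ne') (ENNReal.natCast_ne_top _))

/-- The natural measure `μ = q^ℕ` on the symbolic space of the distinct maps. -/
noncomputable def μ : Measure (ℕ → Fin F.m) := Measure.infinitePi fun _ => F.q.toMeasure

/-- The natural projection `Π x = lim_n S_{x_1} ∘ ⋯ ∘ S_{x_n} (0)`. -/
noncomputable def proj (x : ℕ → Fin F.m) : ℝ :=
  limUnder atTop fun k : ℕ => wordMap F.S ((List.range k).map x) 0

/-- The push forward `ν` of the natural measure under the natural projection. -/
noncomputable def ν : Measure ℝ := F.μ.map F.proj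

/-! ### The basic types -/

/-- The interval `[(i - 1) L, i L]`, an `L`-adic interval of length `L`. -/
def lInterval (i : ℤ) : Set ℝ := Set.Icc (((i : ℝ) - 1) * F.L) ((i : ℝ) * F.L)

lemma one_lt_L : (1 : ℝ) < F.L := by
  have := F.two_le_L
  exact_mod_cast this

lemma S_mem (j : Fin F.m) {x : ℝ} (hx : x ∈ F.I) : F.S j x ∈ F.I := by
  have hL := F.one_lt_L
  have hL0 : (0 : ℝ) < F.L - 1 := by linarith
  have hL1 : (0 : ℝ) < F.L := by linarith
  have ht : (F.τ j : ℝ) ≤ F.tLast := by exact_mod_cast F.τ_le j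
  obtain ⟨h0, h1⟩ := hx
  refine ⟨by unfold S; positivity, ?_⟩
  have h2 : x / F.L ≤ (F.tLast : ℝ) / (F.L - 1) := by
    rw [div_le_iff₀ hL1]
    calc x ≤ _ := h1
      _ = _ := by ring
  have h3 : (F.L : ℝ) * F.tLast / ((F.L : ℝ) - 1) = (F.tLast : ℝ) / (F.L - 1) + F.tLast := by
    field_simp
    ring
  unfold S
  rw [h3]
  linarith

lemma zero_mem_I : (0 : ℝ) ∈ F.I := by
  have hL := F.one_lt_L
  have hL0 : (0 : ℝ) < F.L - 1 := by linarith
  exact ⟨le_rfl, by positivity⟩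

lemma wordMap_S_mem (w : List (Fin F.m)) {x : ℝ} (hx : x ∈ F.I) : wordMap F.S w x ∈ F.I := by
  induction w with
  | nil => exact hx
  | cons j w ih => exact F.S_mem j ih

lemma wordMap_S_mono (w : List (Fin F.m)) : Monotone (wordMap F.S w) := by
  induction w with
  | nil => exact monotone_id
  | cons j w ih =>
    intro x y hxy
    have := ih hxy
    change F.S j (wordMap F.S w x) ≤ F.S j (wordMap F.S w y)
    have hL1 : (0 : ℝ) ≤ F.L := Nat.cast_nonneg _
    exact add_le_add_left (div_le_div_of_nonneg_right this hL1) _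

/-- The limit that defines the natural projection exists. -/
lemma tendsto_proj (x : ℕ → Fin F.m) :
    Tendsto (fun k : ℕ => wordMap F.S ((List.range k).map x) 0) atTop (nhds (F.proj x)) := by
  apply tendsto_nhds_limUnder
  refine ⟨_, tendsto_atTop_ciSup (monotone_nat_of_le_succ fun k => ?_)
    ⟨(F.L : ℝ) * F.tLast / ((F.L : ℝ) - 1), ?_⟩⟩
  · have h : wordMap F.S ((List.range (k + 1)).map x) 0
        = wordMap F.S ((List.range k).map x) (F.S (x k) 0) := by
      simp [wordMap, List.range_succ]
    rw [h]
    exact F.wordMap_S_mono _ (F.S_mem _ F.zero_mem_I).1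
  · rintro _ ⟨k, rfl⟩
    exact (F.wordMap_S_mem _ F.zero_mem_I).2

lemma proj_mem (x : ℕ → Fin F.m) : F.proj x ∈ F.I :=
  isClosed_Icc.mem_of_tendsto (F.tendsto_proj x)
    (Eventually.of_forall fun _ => F.wordMap_S_mem _ F.zero_mem_I)

lemma finite_types : {i : ℤ | 0 < F.ν (F.lInterval i)}.Finite := by
  have hL := F.one_lt_L
  have hL1 : (0 : ℝ) < F.L := by linarith
  set R : ℝ := (F.L : ℝ) * F.tLast / ((F.L : ℝ) - 1) with hR
  refine (Set.finite_Icc (0 : ℤ) (⌈R⌉ + 1)).subset fun i hi => ?_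
  have hne : (F.proj ⁻¹' F.lInterval i).Nonempty := by
    by_contra hcon
    rw [Set.not_nonempty_iff_eq_empty] at hcon
    have hi' : 0 < F.ν (F.lInterval i) := hi
    by_cases hm : AEMeasurable F.proj F.μ
    · rw [ν, Measure.map_apply_of_aemeasurable hm (show MeasurableSet (F.lInterval i) from measurableSet_Icc),
        hcon] at hi'
      simp at hi'
    · rw [ν, Measure.map_of_not_aemeasurable hm] at hi'
      simp at hi'
  obtain ⟨x, hx1, hx2⟩ := hne
  obtain ⟨h0, h1⟩ := F.proj_mem x
  constructor
  · have : (0 : ℝ) ≤ (i : ℝ) := by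
      by_contra hneg
      have := mul_neg_of_neg_of_pos (not_le.1 hneg) hL1
      linarith
    exact_mod_cast this
  · by_contra hcon
    have h2 : (⌈R⌉ : ℝ) + 1 < i := by exact_mod_cast not_le.1 hcon
    have h3 := Int.le_ceil R
    have h4 : 0 ≤ R := le_trans h0 h1
    have h5 : R < ((i : ℝ) - 1) * F.L := by nlinarith
    linarith

/-- The indices `i` of the intervals `[(i - 1) L, i L]` of positive `ν`-measure. -/
noncomputable def types : Finset ℤ := F.finite_types.toFinset

/-- The number of basic types. -/
noncomputable def N : ℕ := F.types.card

/-- The index of the `k`-th basic type, in increasing order. -/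
noncomputable def typeIndex (k : Fin F.N) : ℤ := F.types.orderEmbOfFin rfl k

/-- The basic types `J^0, …, J^{N-1}`. -/
noncomputable def J (k : Fin F.N) : Set ℝ := F.lInterval (F.typeIndex k)

/-- The `a`-th (from left to right) of the `L` intervals of length `1` that subdivide `J^k`. -/
noncomputable def Jsub (k : Fin F.N) (a : Fin F.L) : Set ℝ :=
  Set.Icc (((F.typeIndex k : ℝ) - 1) * F.L + (a : ℕ))
    (((F.typeIndex k : ℝ) - 1) * F.L + (a : ℕ) + 1)

open Classical in
/-- The `N × N` matrices `A_a`: the entry `A_a(ℓ, k)` is `n_i` if `S_i(J^k) = J^ℓ_a` (there is at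
most one such `i`), and `0` if there is no such `i`. -/
noncomputable def A (a : Fin F.L) : Matrix (Fin F.N) (Fin F.N) ℕ :=
  fun l k => if h : ∃ i, F.S i '' F.J k = F.Jsub l a then F.n h.choose else 0

/-- The product `A_{b_1} ⋯ A_{b_n}` along a finite word. -/
noncomputable def Aword (b : List (Fin F.L)) : Matrix (Fin F.N) (Fin F.N) ℕ := (b.map F.A).prod

/-- The column sum `CS_{a,U}`. -/
noncomputable def CS (a : Fin F.L) (U : Fin F.N) : ℕ := ∑ i, F.A a i U

/-! ### The random set -/

/-- The sample space: one subset of `[M]` (given by its indicator) for each node of the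
`M`-ary tree. -/
abbrev Ω : Type := List (Fin F.M) → (Fin F.M → Bool)

/-- The law of the coins: they are all independent, and each equals `true` (head) with
probability `p` and `false` with probability `1 - p`. -/
noncomputable def coinLaw (p : unitInterval) : Measure F.Ω :=
  Measure.infinitePi fun _ : List (Fin F.M) =>
    Measure.pi fun _ : Fin F.M => bernoulliMeasure true false p

/-- The retained words of length `n`: for every `k < n` the coin that node `w_1 ⋯ w_k` tosses for
its child `w_{k+1}` shows head. -/
def retained (ω : F.Ω) (n : ℕ) : Set (List (Fin F.M)) :=
  {w | w.length = n ∧ ∀ (k : ℕ) (hk : k < w.length), ω (w.take k) w[k] = true}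

/-- Non-extinction: some infinite word has all its finite prefixes retained. -/
def nonExtinction : Set F.Ω :=
  {ω | ∃ x : ℕ → Fin F.M, ∀ n, (List.range n).map x ∈ F.retained ω n}

/-- The coin tossing integer self-similar set
`Λ_F(p, ω) = ⋂_{n ≥ 1} ⋃_{w retained of length n} f_w(I)`. -/
def Λ (ω : F.Ω) : Set ℝ :=
  ⋂ n : ℕ, ⋂ _ : 1 ≤ n, ⋃ w ∈ F.retained ω n, wordMap F.f w '' F.I

end IntegerIFS

/-! Fix a column-sum margin `θ > 1` with `θ ^ 2 ≤ p * CS a V` for all `a` and `V`. Inside a basic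
type, follow the `L`-adic parts by their addresses. A retained word is aligned with a part, with
type `V`, if it maps `J^V` onto that part along a chain of basic types. If every part of generation
`m` has at least `θ ^ m` aligned words of each type, then the part one digit `a` deeper has at least
`θ ^ m * CS a V` candidates of type `V`. About a proportion `p` of them is retained, so Hoeffding's
inequality leaves at least `θ ^ (m + 1)`, except with probability exponentially small in `θ ^ m`.
The number of parts grows only like `L ^ m`, so the exceptional probabilities are summable.

The positive row starts the induction: when the early coins are all heads, the part of `J^U`
addressed by `b` has aligned words of every type. Forcing heads further, up to a generation beyond
which the exceptional probabilities sum to less than `1`, shows that the growth never fails with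
positive probability (`coinLaw_iInter_abundant_pos`). Then every point of half of the starting part
is a limit of images of retained words, so `Λ` contains an interval
(`exists_Icc_subset_Λ_of_aligned`).

Positive probability becomes certainty on non-extinction by a zero-one law
(`coinLaw_nonExtinction_diff_hereditary`): the growth event almost surely occurs in the subtree of
some retained word, and an interval in the limit set of that subtree is mapped to an interval in
`Λ`. -/

namespace IntegerIFS

variable (F : IntegerIFS)

/-! ### The coins as one independent family -/

section Coins

variable (p : unitInterval)

lemma coinLaw_eq_infinitePi : F.coinLaw p = Measure.infinitePi fun _ : List (Fin F.M) =>
    Measure.infinitePi fun _ : Fin F.M => bernoulliMeasure true false p := by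
  simp_rw [coinLaw, Measure.infinitePi_eq_pi]

instance : IsProbabilityMeasure (F.coinLaw p) := by
  rw [coinLaw_eq_infinitePi]; infer_instance

lemma coinLaw_map_uncurry :
    (F.coinLaw p).map (fun ω (c : List (Fin F.M) × Fin F.M) => ω c.1 c.2) =
      Measure.infinitePi fun _ => bernoulliMeasure true false p := by
  rw [coinLaw_eq_infinitePi]
  exact Measure.infinitePi_map_curry_symm fun (_ : List (Fin F.M)) (_ : Fin F.M) =>
    bernoulliMeasure true false p

lemma measurable_coin (w : List (Fin F.M)) (i : Fin F.M) :
    Measurable fun ω : F.Ω => ω w i :=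
  (measurable_pi_apply i).comp (measurable_pi_apply w)

lemma iIndepFun_coin :
    iIndepFun (fun (c : List (Fin F.M) × Fin F.M) (ω : F.Ω) => ω c.1 c.2) (F.coinLaw p) := by
  rw [coinLaw_eq_infinitePi]
  exact iIndepFun_uncurry_infinitePi' (X := fun _ _ => id)
    (fun (_ : List (Fin F.M)) (_ : Fin F.M) => bernoulliMeasure true false p)
    (fun _ _ => measurable_id)

lemma measurable_uncurry_coins :
    Measurable fun (ω : F.Ω) (c : List (Fin F.M) × Fin F.M) => ω c.1 c.2 :=
  measurable_pi_lambda _ fun c => F.measurable_coin c.1 c.2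

lemma coinLaw_map_coin (w : List (Fin F.M)) (i : Fin F.M) :
    (F.coinLaw p).map (fun ω => ω w i) = bernoulliMeasure true false p := by
  have h := congrArg (Measure.map fun f : List (Fin F.M) × Fin F.M → Bool => f (w, i))
    (F.coinLaw_map_uncurry p)
  rw [Measure.map_map (by fun_prop) F.measurable_uncurry_coins] at h
  rw [Measure.infinitePi_map_eval] at h
  exact h

end Coins

/-! ### Branching at the root -/

/-- The coins in the subtree rooted at the child `i` of the root. -/
def sub (i : Fin F.M) (ω : F.Ω) : F.Ω := fun w => ω (i :: w)

lemma measurable_sub (i : Fin F.M) : Measurable (F.sub i) :=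
  measurable_pi_lambda _ fun w => measurable_pi_apply (i :: w)

section Children

variable (p : unitInterval)

/-- Splitting off one coordinate of a product of identical laws. -/
lemma infinitePi_option_apply {κ : Type*} {X : Type*} [MeasurableSpace X] (ρ : Measure X)
    [IsProbabilityMeasure ρ] {s : Set X} (hs : MeasurableSet s) {B : Set (κ → X)}
    (hB : MeasurableSet B) :
    Measure.infinitePi (fun _ : Option κ => ρ)
        {z | z none ∈ s ∧ (fun k => z (some k)) ∈ B} =
      ρ s * Measure.infinitePi (fun _ : κ => ρ) B := by
  classical
  set Q := Measure.infinitePi (fun _ : Option κ => ρ)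
  have hi : iIndepFun (fun (k : Option κ) (z : Option κ → X) => z k) Q :=
    iIndepFun_infinitePi (X := fun _ => id) fun _ => measurable_id
  have h1 : IndepFun (fun z : Option κ → X => z none) (fun z k => z (some k)) Q := by
    refine IndepFun.indepFun_process (measurable_pi_apply _) (fun k => measurable_pi_apply _)
      fun I => ?_
    have h2 := hi.indepFun_finset {none} (I.map Function.Embedding.some) (by simp)
      (fun _ => measurable_pi_apply _)
    exact h2.comp (φ := fun u : ({none} : Finset (Option κ)) → X => u ⟨none, by simp⟩)
      (ψ := fun (u : I.map Function.Embedding.some → X) (k : I) => u ⟨some k, by simp⟩)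
      (by fun_prop) (by fun_prop)
  have h3 := h1.measure_inter_preimage_eq_mul _ _ hs hB
  have h4 : Q.map (fun z : Option κ → X => z none) = ρ := Measure.infinitePi_map_eval _ _
  have h5 : Q.map (fun (z : Option κ → X) k => z (some k)) =
      Measure.infinitePi (fun _ : κ => ρ) :=
    Measure.map_infinitePi_infinitePi_of_inj (Option.some_injective κ)
  rw [← Measure.map_apply (measurable_pi_apply _) hs, h4, ← Measure.map_apply
    (measurable_pi_lambda _ fun k => measurable_pi_apply _) hB, h5] at h3
  exact h3

/-- The children act independently, and each violates the condition with probability `p * (1 - P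
B)`: its coin shows head and its subtree, which has the law of the whole tree, is outside `B`. -/
lemma coinLaw_real_forall_child {B : Set F.Ω} (hB : MeasurableSet B) :
    (F.coinLaw p).real {ω | ∀ i, ω [] i = true → F.sub i ω ∈ B} =
      (1 - p + p * (F.coinLaw p).real B) ^ F.M := by
  set ρ : Measure Bool := bernoulliMeasure true false p
  let κ := List (Fin F.M) × Fin F.M
  -- Block `i` collects the root's coin for `i` (index `none`) and the coins of the subtree at `i`.
  -- Injectivity of `e` makes the blocks independent.
  let e : Fin F.M × Option κ → κ := fun x => x.2.elim ([], x.1) fun y => (x.1 :: y.1, y.2)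
  have he : Function.Injective e := by
    rintro ⟨i, _ | ⟨w, j⟩⟩ ⟨i', _ | ⟨w', j'⟩⟩ h <;>
      simp only [e, κ, Option.elim, Prod.mk.injEq, List.cons.injEq] at h <;> simp_all
  let B' : Set (κ → Bool) := {z | (fun w j => z (w, j)) ∈ B}
  have hB' : MeasurableSet B' :=
    hB.preimage (measurable_pi_lambda _ fun w => measurable_pi_lambda _ fun j =>
      measurable_pi_apply _)
  have hPB : F.coinLaw p B = Measure.infinitePi (fun _ : κ => ρ) B' := by
    rw [← F.coinLaw_map_uncurry p, Measure.map_apply F.measurable_uncurry_coins hB']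
    rfl
  let C : Set (Option κ → Bool) := {z | z none ∈ ({true} : Set Bool) ∧ (fun k => z (some k)) ∈ B'ᶜ}
  have hC : MeasurableSet C := by
    refine (measurable_pi_apply none (MeasurableSet.of_discrete (s := {true}))).inter
      (hB'.compl.preimage (measurable_pi_lambda _ fun k => measurable_pi_apply (some k)))
  have hmap : (F.coinLaw p).map (fun ω i k => ω (e (i, k)).1 (e (i, k)).2) =
      Measure.infinitePi fun _ : Fin F.M => Measure.infinitePi fun _ : Option κ => ρ := by
    rw [← Measure.infinitePi_map_curry (fun (_ : Fin F.M) (_ : Option κ) => ρ),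
      ← Measure.map_infinitePi_infinitePi_of_inj (P := fun _ : κ => ρ) he,
      ← F.coinLaw_map_uncurry p, Measure.map_map (by fun_prop) (by fun_prop),
      Measure.map_map (by fun_prop) F.measurable_uncurry_coins]
    rfl
  have hset : {ω | ∀ i, ω [] i = true → F.sub i ω ∈ B} =
      (fun (ω : F.Ω) i k => ω (e (i, k)).1 (e (i, k)).2) ⁻¹' (Set.pi Set.univ fun _ => Cᶜ) := by
    ext ω
    simp only [Set.mem_ofPred_eq, Set.mem_preimage, Set.mem_pi, Set.mem_univ, true_imp_iff, C,
      Set.mem_compl_iff, not_and, not_not, Set.mem_singleton_iff, B', e]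
    rfl
  have h1 : F.coinLaw p {ω | ∀ i, ω [] i = true → F.sub i ω ∈ B} =
      (Measure.infinitePi (fun _ : Option κ => ρ) Cᶜ) ^ F.M := by
    rw [hset, ← Measure.map_apply (measurable_pi_lambda _ fun i => measurable_pi_lambda _ fun k =>
      F.measurable_coin _ _) (MeasurableSet.univ_pi fun _ => hC.compl), hmap,
      Measure.infinitePi_eq_pi, Measure.pi_pi]
    simp
  have h2 : (Measure.infinitePi (fun _ : Option κ => ρ)).real C =
      p * (1 - (F.coinLaw p).real B) := by
    have h3 := infinitePi_option_apply ρ (MeasurableSet.of_discrete (s := {true})) hB'.compl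
    have h4 : (Measure.infinitePi (fun _ : κ => ρ)).real B'ᶜ = 1 - (F.coinLaw p).real B := by
      rw [probReal_compl_eq_one_sub hB', measureReal_def, ← hPB]; rfl
    have h5 : ρ.real {true} = p := by
      simp [ρ]
    rw [measureReal_def, h3, ENNReal.toReal_mul, ← measureReal_def, ← measureReal_def, h4, h5]
  rw [measureReal_def, h1, ENNReal.toReal_pow, ← measureReal_def, probReal_compl_eq_one_sub hC, h2]
  ring

end Children

/-! ### Events of finitely many nodes, and concentration -/

section Independence

/-- The coins of finitely many nodes range over a finite discrete space, so measurability of such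
events is automatic. -/
lemma exists_preimage_restrict {S : Finset (List (Fin F.M))} {s : Set F.Ω}
    (hs : DependsOn (· ∈ s) (S : Set (List (Fin F.M)))) :
    ∃ s' : Set (S → Fin F.M → Bool), MeasurableSet s' ∧ S.restrict ⁻¹' s' = s := by
  refine ⟨S.restrict '' s, MeasurableSet.of_discrete, ?_⟩
  refine Set.Subset.antisymm ?_ (Set.subset_preimage_image _ _)
  rintro ω ⟨ω', hω', h⟩
  have h1 : (ω ∈ s) = (ω' ∈ s) := hs fun w hw => (congrFun h ⟨w, hw⟩).symm
  exact h1.mpr hω'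

lemma measurableSet_of_dependsOn {S : Finset (List (Fin F.M))} {s : Set F.Ω}
    (hs : DependsOn (· ∈ s) (S : Set (List (Fin F.M)))) : MeasurableSet s := by
  obtain ⟨s', hs', rfl⟩ := F.exists_preimage_restrict hs
  exact hs'.preimage (Finset.measurable_restrict S)

lemma coinLaw_inter_of_dependsOn (p : unitInterval) {S T : Finset (List (Fin F.M))}
    (hST : Disjoint S T) {s t : Set F.Ω}
    (hs : DependsOn (· ∈ s) (S : Set (List (Fin F.M))))
    (ht : DependsOn (· ∈ t) (T : Set (List (Fin F.M)))) :
    F.coinLaw p (s ∩ t) = F.coinLaw p s * F.coinLaw p t := by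
  obtain ⟨s', hs', rfl⟩ := F.exists_preimage_restrict hs
  obtain ⟨t', ht', rfl⟩ := F.exists_preimage_restrict ht
  have hi : iIndepFun (fun (w : List (Fin F.M)) (ω : F.Ω) => ω w) (F.coinLaw p) :=
    iIndepFun_infinitePi (X := fun _ => id) fun _ => measurable_id
  exact (hi.indepFun_finset S T hST fun w => measurable_pi_apply w).measure_inter_preimage_eq_mul
    _ _ hs' ht'

/-- The words of length less than `n`. -/
noncomputable def below (n : ℕ) : Finset (List (Fin F.M)) :=
  (List.finite_length_lt (Fin F.M) n).toFinset

@[simp] lemma mem_below {n : ℕ} {w : List (Fin F.M)} : w ∈ F.below n ↔ w.length < n := by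
  simp [below]

lemma coe_below_mono {n k : ℕ} (h : n ≤ k) :
    (F.below n : Set (List (Fin F.M))) ⊆ F.below k := by
  intro w hw
  simp only [Finset.mem_coe, mem_below] at hw ⊢
  omega

/-- Hoeffding's inequality for the number of heads among finitely many coins. -/
lemma coinLaw_card_heads_le (p : unitInterval) (s : Finset (List (Fin F.M) × Fin F.M)) {η : ℝ}
    (hη : 0 ≤ η) :
    (F.coinLaw p).real {ω | ((s.filter fun c => ω c.1 c.2 = true).card : ℝ) ≤ (p - η) * s.card} ≤
      Real.exp (-(2 * η ^ 2) * s.card) := by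
  rcases s.eq_empty_or_nonempty with rfl | hne
  · simp
  -- The sign turns the lower tail of the number of heads into the upper tail that Hoeffding's
  -- inequality bounds.
  let g : Bool → ℝ := fun b => if b then -1 else 0
  have hg : Measurable g := measurable_from_top
  have hmean : ∀ c : List (Fin F.M) × Fin F.M, (F.coinLaw p)[fun ω => g (ω c.1 c.2)] = -(p : ℝ) := by
    intro c
    rw [← integral_map (φ := fun ω : F.Ω => ω c.1 c.2) (F.measurable_coin _ _).aemeasurable
      hg.aestronglyMeasurable, coinLaw_map_coin, integral_bernoulliMeasure]
    simp [g]
  have hsub : ∀ c ∈ s, HasSubgaussianMGF (fun ω : F.Ω => g (ω c.1 c.2) - (-(p : ℝ)))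
      ((‖(0 : ℝ) - (-1)‖₊ / 2) ^ 2) (F.coinLaw p) := by
    intro c _
    rw [← hmean c]
    refine hasSubgaussianMGF_of_mem_Icc (hg.comp (F.measurable_coin _ _)).aemeasurable
      (ae_of_all _ fun ω => ?_)
    cases h : ω c.1 c.2 <;> simp [g]
  have hind : iIndepFun (fun (c : List (Fin F.M) × Fin F.M) (ω : F.Ω) => g (ω c.1 c.2) - (-(p : ℝ)))
      (F.coinLaw p) :=
    (F.iIndepFun_coin p).comp (fun _ b => g b - (-(p : ℝ))) fun _ => measurable_from_top
  have h := HasSubgaussianMGF.measure_sum_ge_le_of_iIndepFun hind hsub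
    (ε := η * s.card) (by positivity)
  have hpos : (0 : ℝ) < s.card := by exact_mod_cast hne.card_pos
  refine (measureReal_mono ?_).trans (h.trans_eq ?_)
  · intro ω hω
    simp only [Set.mem_ofPred_eq] at hω ⊢
    have h1 : ∑ c ∈ s, (g (ω c.1 c.2) - (-(p : ℝ))) =
        p * s.card - ((s.filter fun c => ω c.1 c.2 = true).card : ℝ) := by
      rw [Finset.sum_sub_distrib, Finset.card_filter]
      simp only [g, Finset.sum_const, nsmul_eq_mul]
      push_cast
      have : ∀ c ∈ s, (if ω c.1 c.2 = true then (-1 : ℝ) else 0) =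
        -(if ω c.1 c.2 = true then (1 : ℝ) else 0) := by intro c _; split_ifs <;> simp
      rw [Finset.sum_congr rfl this, Finset.sum_neg_distrib]
      ring
    rw [h1]
    linarith
  · congr 1
    simp only [Finset.sum_const, nsmul_eq_mul]
    simp
    field_simp

/-- The random set `C` is determined by the nodes of length less than `n`, while its coins are
tossed at nodes of length `n`. Given the value of `C`, these coins are therefore still independent
and fresh. -/
lemma coinLaw_card_heads_random_le (p : unitInterval) {n : ℕ} {D : Set F.Ω}
    (hD : DependsOn (· ∈ D) (F.below n : Set (List (Fin F.M))))
    {C : F.Ω → Finset (List (Fin F.M) × Fin F.M)}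
    (hC : DependsOn C (F.below n : Set (List (Fin F.M))))
    (hlen : ∀ ω, ∀ c ∈ C ω, c.1.length = n) {η K : ℝ} (hη : 0 ≤ η)
    (hK : ∀ ω ∈ D, K ≤ (C ω).card) :
    F.coinLaw p (D ∩ {ω | (((C ω).filter fun c => ω c.1 c.2 = true).card : ℝ) ≤
        (p - η) * (C ω).card}) ≤
      F.coinLaw p D * ENNReal.ofReal (Real.exp (-(2 * η ^ 2) * K)) := by
  classical
  set r := ENNReal.ofReal (Real.exp (-(2 * η ^ 2) * K))
  let Ds : Finset (List (Fin F.M) × Fin F.M) → Set F.Ω := fun s => D ∩ {ω | C ω = s}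
  have hDs : ∀ s, DependsOn (· ∈ Ds s) (F.below n : Set (List (Fin F.M))) := by
    intro s ω ω' h
    have h1 : (ω ∈ D) = (ω' ∈ D) := hD h
    have h2 : C ω = C ω' := hC h
    simp only [Ds, Set.mem_inter_iff, Set.mem_ofPred_eq, h1, h2]
  let Hs : Finset (List (Fin F.M) × Fin F.M) → Set F.Ω := fun s =>
    {ω | ((s.filter fun c => ω c.1 c.2 = true).card : ℝ) ≤ (p - η) * s.card}
  have hD_eq : F.coinLaw p D = ∑' s, F.coinLaw p (Ds s) := by
    rw [← measure_iUnion]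
    · congr 1
      ext ω
      simp [Ds]
    · intro s s' hss
      refine Set.disjoint_left.2 fun ω h h' => hss (h.2.symm.trans h'.2)
    · exact fun s => F.measurableSet_of_dependsOn (hDs s)
  rw [hD_eq, ← ENNReal.tsum_mul_right]
  refine (measure_mono (t := ⋃ s, Ds s ∩ Hs s) ?_).trans ((measure_iUnion_le _).trans
    (ENNReal.tsum_le_tsum fun s => ?_))
  · rintro ω ⟨h1, h2⟩
    exact Set.mem_iUnion.2 ⟨C ω, ⟨h1, rfl⟩, h2⟩
  -- One sample point of `Ds s` transfers the length and cardinality bounds to the fixed set `s`.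
  · rcases (Ds s).eq_empty_or_nonempty with h0 | ⟨ω₀, hω₀, hs₀⟩
    · simp [h0]
    have hs₀' : C ω₀ = s := hs₀
    have hlen' : ∀ c ∈ s, c.1.length = n := hs₀' ▸ hlen ω₀
    have hK' : K ≤ s.card := hs₀' ▸ hK ω₀ hω₀
    have hHs : DependsOn (· ∈ Hs s) ((s.image Prod.fst : Finset _) : Set (List (Fin F.M))) := by
      intro ω ω' h
      have : (s.filter fun c => ω c.1 c.2 = true) = s.filter fun c => ω' c.1 c.2 = true := by
        refine Finset.filter_congr fun c hc => ?_
        rw [h c.1 (Finset.mem_coe.2 (Finset.mem_image_of_mem _ hc))]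
      simp only [Hs, Set.mem_ofPred_eq, this]
    have hdisj : Disjoint (F.below n) (s.image Prod.fst) := by
      refine Finset.disjoint_left.2 fun w hw hw' => ?_
      obtain ⟨c, hc, rfl⟩ := Finset.mem_image.1 hw'
      have := hlen' c hc
      rw [mem_below] at hw
      omega
    rw [F.coinLaw_inter_of_dependsOn p hdisj (hDs s) hHs]
    gcongr
    rw [← ofReal_measureReal]
    refine ENNReal.ofReal_le_ofReal ((F.coinLaw_card_heads_le p s hη).trans ?_)
    refine Real.exp_le_exp.2 ?_
    have : 0 ≤ 2 * η ^ 2 := by positivity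
    nlinarith

end Independence

/-! ### Retained words and König's lemma -/

section Retained

variable {F} {ω : F.Ω} {n : ℕ} {w : List (Fin F.M)} {i : Fin F.M}

@[simp] lemma mem_retained_zero : w ∈ F.retained ω 0 ↔ w = [] := by
  constructor
  · exact fun h => List.length_eq_zero_iff.1 h.1
  · rintro rfl
    exact ⟨rfl, fun k hk => absurd hk (Nat.not_lt_zero _)⟩

lemma cons_mem_retained :
    i :: w ∈ F.retained ω (n + 1) ↔ ω [] i = true ∧ w ∈ F.retained (F.sub i ω) n := by
  constructor
  · rintro ⟨h1, h2⟩
    refine ⟨h2 0 (by simp), by simpa using h1, fun k hk => ?_⟩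
    exact h2 (k + 1) (by simpa using hk)
  · rintro ⟨h0, h1, h2⟩
    refine ⟨by simp [h1], fun k hk => ?_⟩
    cases k with
    | zero => simpa using h0
    | succ k => exact h2 k (by simpa using hk)

lemma append_singleton_mem_retained (h : w ∈ F.retained ω n) (hi : ω w i = true) :
    w ++ [i] ∈ F.retained ω (n + 1) := by
  refine ⟨by simp [h.1], fun k hk => ?_⟩
  rcases Nat.lt_or_ge k w.length with hk' | hk'
  · rw [List.take_append_of_le_length hk'.le, List.getElem_append_left hk']
    exact h.2 k hk'
  · obtain rfl : k = w.length := by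
      rw [List.length_append, List.length_singleton] at hk
      omega
    simpa using hi

lemma take_mem_retained {m : ℕ} (h : w ∈ F.retained ω n) (hm : m ≤ n) :
    w.take m ∈ F.retained ω m := by
  refine ⟨by rw [List.length_take, h.1]; omega, fun k hk => ?_⟩
  rw [List.length_take] at hk
  have := h.2 k (by omega)
  rw [List.take_take, min_eq_left (by omega), List.getElem_take]
  exact this

lemma finite_retained (ω : F.Ω) (n : ℕ) : (F.retained ω n).Finite :=
  (List.finite_length_eq (Fin F.M) n).subset fun _ h => h.1

lemma retained_nonempty_succ :
    (F.retained ω (n + 1)).Nonempty ↔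
      ∃ i, ω [] i = true ∧ (F.retained (F.sub i ω) n).Nonempty := by
  constructor
  · rintro ⟨w, hw⟩
    cases w with
    | nil => exact absurd hw.1 (by simp)
    | cons i w =>
      obtain ⟨h1, h2⟩ := cons_mem_retained.1 hw
      exact ⟨i, h1, w, h2⟩
  · rintro ⟨i, hi, w, hw⟩
    exact ⟨i :: w, cons_mem_retained.2 ⟨hi, hw⟩⟩

/-- König's lemma, one step: if there are retained words of all lengths, then the same holds in
the subtree of some retained child of the root. -/
lemma exists_child_of_forall_retained_nonempty (h : ∀ n, (F.retained ω n).Nonempty) :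
    ∃ i, ω [] i = true ∧ ∀ n, (F.retained (F.sub i ω) n).Nonempty := by
  by_contra! hcon
  have h1 : ∀ i : Fin F.M, ∃ n, ω [] i = true → F.retained (F.sub i ω) n = ∅ := by
    intro i
    by_cases hi : ω [] i = true
    · obtain ⟨n, hn⟩ := hcon i hi
      exact ⟨n, fun _ => hn⟩
    · exact ⟨0, fun h => absurd h hi⟩
  choose N hN using h1
  -- A retained word longer than every child's extinction time passes through some child and
  -- truncates to a forbidden word there.
  obtain ⟨i, hi, w, hw⟩ := retained_nonempty_succ.1 (h (Finset.univ.sup N + 1))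
  have := take_mem_retained hw (Finset.le_sup (f := N) (Finset.mem_univ i))
  rw [hN i hi] at this
  exact this

lemma mem_nonExtinction_iff_exists_child :
    ω ∈ F.nonExtinction ↔ ∃ i, ω [] i = true ∧ F.sub i ω ∈ F.nonExtinction := by
  have hr : ∀ (x : ℕ → Fin F.M) n, (List.range (n + 1)).map x =
      x 0 :: (List.range n).map fun k => x (k + 1) := by
    intro x n
    rw [List.range_succ_eq_map]
    simp [Function.comp_def]
  constructor
  · rintro ⟨x, hx⟩
    have h1 : ∀ n, _ := fun n => cons_mem_retained.1 (hr x n ▸ hx (n + 1))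
    exact ⟨x 0, (h1 0).1, fun k => x (k + 1), fun n => (h1 n).2⟩
  · rintro ⟨i, hi, x, hx⟩
    refine ⟨fun k => Nat.casesOn k i x, fun n => ?_⟩
    cases n with
    | zero => simp
    | succ n =>
      rw [hr]
      exact cons_mem_retained.2 ⟨hi, hx n⟩

lemma mem_nonExtinction_iff_forall_retained_nonempty :
    ω ∈ F.nonExtinction ↔ ∀ n, (F.retained ω n).Nonempty := by
  constructor
  · rintro ⟨x, hx⟩ n
    exact ⟨_, hx n⟩
  · intro h
    choose c hc hc' using
      fun ω : {ω : F.Ω // ∀ n, (F.retained ω n).Nonempty} =>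
        exists_child_of_forall_retained_nonempty ω.2
    let next : {ω : F.Ω // ∀ n, (F.retained ω n).Nonempty} →
        {ω : F.Ω // ∀ n, (F.retained ω n).Nonempty} := fun ω => ⟨F.sub (c ω) ω, hc' ω⟩
    have key : ∀ n (ω : {ω : F.Ω // ∀ n, (F.retained ω n).Nonempty}),
        (List.range n).map (fun k => c (next^[k] ω)) ∈ F.retained ω.1 n := by
      intro n
      induction n with
      | zero => simp
      | succ n ih =>
        intro ω
        rw [List.range_succ_eq_map]
        refine cons_mem_retained.2 ⟨hc ω, ?_⟩
        have := ih (next ω)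
        simpa [Function.comp_def] using this
    exact ⟨_, fun n => key n ⟨ω, h⟩⟩

end Retained

/-! ### Measurability and the zero-one law -/

lemma measurableSet_child {B : Set F.Ω} (hB : MeasurableSet B) :
    MeasurableSet {ω : F.Ω | ∃ i, ω [] i = true ∧ F.sub i ω ∈ B} := by
  have : {ω : F.Ω | ∃ i, ω [] i = true ∧ F.sub i ω ∈ B} =
      ⋃ i, (fun ω : F.Ω => ω [] i) ⁻¹' {true} ∩ F.sub i ⁻¹' B := by
    ext ω; simp
  rw [this]
  exact MeasurableSet.iUnion fun i => (F.measurable_coin [] i MeasurableSet.of_discrete).inter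
    (hB.preimage (F.measurable_sub i))

lemma measurableSet_retained_nonempty (n : ℕ) :
    MeasurableSet {ω : F.Ω | (F.retained ω n).Nonempty} := by
  induction n with
  | zero =>
    convert! MeasurableSet.univ
    exact Set.eq_univ_of_forall fun ω => ⟨[], by simp⟩
  | succ n ih =>
    simp_rw [retained_nonempty_succ]
    exact F.measurableSet_child ih

lemma measurableSet_nonExtinction : MeasurableSet F.nonExtinction := by
  have : F.nonExtinction = ⋂ n, {ω : F.Ω | (F.retained ω n).Nonempty} := by
    ext ω
    simp [mem_nonExtinction_iff_forall_retained_nonempty]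
  rw [this]
  exact MeasurableSet.iInter F.measurableSet_retained_nonempty

/-- The event that `G` happens in the subtree of some retained word. -/
inductive Hereditary (G : Set F.Ω) : F.Ω → Prop
  | root {ω : F.Ω} : ω ∈ G → Hereditary G ω
  | child {ω : F.Ω} {i : Fin F.M} : ω [] i = true → Hereditary G (F.sub i ω) → Hereditary G ω

lemma measurableSet_hereditary {G : Set F.Ω} (hG : MeasurableSet G) :
    MeasurableSet {ω | F.Hereditary G ω} := by
  let it : ℕ → Set F.Ω := fun n =>
    (fun B : Set F.Ω => {ω : F.Ω | ∃ i, ω [] i = true ∧ F.sub i ω ∈ B})^[n] G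
  have hit : ∀ n, it (n + 1) = {ω : F.Ω | ∃ i, ω [] i = true ∧ F.sub i ω ∈ it n} := fun n =>
    Function.iterate_succ_apply' _ n G
  have : {ω | F.Hereditary G ω} = ⋃ n, it n := by
    refine Set.Subset.antisymm (fun ω hω => ?_) (Set.iUnion_subset fun n => ?_)
    · rw [Set.mem_iUnion]
      induction hω with
      | root h => exact ⟨0, h⟩
      | @child ω i hi _ ih =>
        obtain ⟨n, hn⟩ := ih
        exact ⟨n + 1, by rw [hit]; exact ⟨i, hi, hn⟩⟩
    · induction n with
      | zero => exact fun ω h => .root h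
      | succ n ih =>
        rw [hit]
        rintro ω ⟨i, hi, h⟩
        exact .child hi (ih h)
  rw [this]
  refine MeasurableSet.iUnion fun n => ?_
  induction n with
  | zero => exact hG
  | succ n ih =>
    rw [hit]
    exact F.measurableSet_child ih

/-- Below `1`, the strictly convex function `q ↦ (1 - p + p q) ^ M` is above the diagonal only up to
its fixed point. -/
lemma eq_of_fixedPoint_of_le {M : ℕ} (hM : 2 ≤ M) {p η q : ℝ} (hp0 : 0 < p) (hp1 : p ≤ 1)
    (hη : 0 ≤ η) (hηq : η ≤ q) (hq : q < 1) (h1 : η = (1 - p + p * η) ^ M)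
    (h2 : q ≤ (1 - p + p * q) ^ M) : η = q := by
  by_contra hne
  have hlt : η < q := lt_of_le_of_ne hηq hne
  have hpη : 0 ≤ p * η := by positivity
  have huv : 1 - p + p * η < 1 - p + p * q := by nlinarith
  have hv1 : 1 - p + p * q < 1 := by nlinarith
  -- If `η < q`, the chord of `(1 - p + p q) ^ M` over `[η, q]` has slope at least `1` and the one
  -- over `[q, 1]` slope at most `1`, against strict convexity.
  have h := (strictConvexOn_pow hM).slope_strict_mono_adjacent
    (x := 1 - p + p * η) (y := 1 - p + p * q) (z := 1) (Set.mem_Ici.2 (by linarith))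
    (Set.mem_Ici.2 zero_le_one) huv hv1
  rw [← h1, one_pow, div_lt_div_iff₀ (by linarith) (by linarith)] at h
  have e1 : 1 - (1 - p + p * q) = p * (1 - q) := by ring
  have e2 : 1 - p + p * q - (1 - p + p * η) = p * (q - η) := by ring
  rw [e1, e2] at h
  have h3 : (q - η) * (p * (1 - q)) ≤ ((1 - p + p * q) ^ M - η) * (p * (1 - q)) :=
    mul_le_mul_of_nonneg_right (by linarith) (mul_nonneg hp0.le (by linarith))
  have h4 : (1 - (1 - p + p * q) ^ M) * (p * (q - η)) ≤ (1 - q) * (p * (q - η)) :=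
    mul_le_mul_of_nonneg_right (by linarith) (mul_nonneg hp0.le (by linarith))
  linarith

/-- A zero-one law for Galton-Watson trees: an event of positive probability that forces
non-extinction happens, on non-extinction, almost surely in the subtree of some retained word. -/
lemma coinLaw_nonExtinction_diff_hereditary (hM : 2 ≤ F.M) (p : unitInterval) (hp : 0 < p)
    {G : Set F.Ω} (hG : MeasurableSet G) (hGne : G ⊆ F.nonExtinction) (hpos : 0 < F.coinLaw p G) :
    F.coinLaw p (F.nonExtinction \ {ω | F.Hereditary G ω}) = 0 := by
  set H : Set F.Ω := {ω | F.Hereditary G ω} with hH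
  have hHm : MeasurableSet H := F.measurableSet_hereditary hG
  have hNm := F.measurableSet_nonExtinction
  have hHN : H ⊆ F.nonExtinction := by
    intro ω hω
    induction hω with
    | root h => exact hGne h
    | child hi _ ih => exact mem_nonExtinction_iff_exists_child.2 ⟨_, hi, ih⟩
  have h1 : (F.coinLaw p).real F.nonExtinctionᶜ =
      (1 - p + p * (F.coinLaw p).real F.nonExtinctionᶜ) ^ F.M := by
    rw [← F.coinLaw_real_forall_child p hNm.compl]
    congr 1
    ext ω
    rw [Set.mem_compl_iff, mem_nonExtinction_iff_exists_child]
    simp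
  -- Only an inequality here, since `H` can also occur through `G` at the root.
  have h2 : (F.coinLaw p).real Hᶜ ≤ (1 - p + p * (F.coinLaw p).real Hᶜ) ^ F.M := by
    rw [← F.coinLaw_real_forall_child p hHm.compl]
    exact measureReal_mono fun ω hω i hi h => hω (.child hi h)
  have h3 : (F.coinLaw p).real Hᶜ < 1 := by
    rw [probReal_compl_eq_one_sub hHm]
    have : 0 < (F.coinLaw p).real H :=
      ENNReal.toReal_pos (hpos.trans_le (measure_mono fun ω h => .root h)).ne' (measure_ne_top _ _)
    linarith
  have h4 := eq_of_fixedPoint_of_le hM (by exact_mod_cast hp) p.2.2 measureReal_nonneg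
    (measureReal_mono (Set.compl_subset_compl.2 hHN)) h3 h1 h2
  rw [probReal_compl_eq_one_sub hHm, probReal_compl_eq_one_sub hNm] at h4
  rw [← measureReal_eq_zero_iff, measureReal_sdiff hHN hHm]
  linarith

/-! ### Images of `Λ` under the maps, and limit points -/

section Geometry

lemma f_mem_I (i : Fin F.M) {x : ℝ} (hx : x ∈ F.I) : F.f i x ∈ F.I := by
  obtain ⟨j, hj, -⟩ := F.existsUnique_τ i
  have h := F.S_mem j hx
  rw [S, hj] at h
  exact h

lemma wordMap_f_mem_I (w : List (Fin F.M)) {x : ℝ} (hx : x ∈ F.I) : wordMap F.f w x ∈ F.I := by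
  induction w with
  | nil => exact hx
  | cons i w ih => exact F.f_mem_I i ih

lemma wordMap_append {α : Type*} (g : α → ℝ → ℝ) (u w : List α) (x : ℝ) :
    wordMap g (u ++ w) x = wordMap g u (wordMap g w x) :=
  List.foldr_append

lemma wordMap_f_eq (w : List (Fin F.M)) (x : ℝ) :
    wordMap F.f w x = x / F.L ^ w.length + wordMap F.f w 0 := by
  have hL : (F.L : ℝ) ≠ 0 := by have := F.one_lt_L; positivity
  induction w with
  | nil => simp [wordMap]
  | cons i w ih =>
    change F.f i (wordMap F.f w x) = _ + F.f i (wordMap F.f w 0)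
    rw [ih, f, f, List.length_cons]
    field_simp
    ring

variable {F}

lemma Λ_subset_I (ω : F.Ω) : F.Λ ω ⊆ F.I := by
  intro y hy
  obtain ⟨w, -, z, hz, rfl⟩ := Set.mem_iUnion₂.1 (Set.mem_iInter₂.1 hy 1 le_rfl)
  exact F.wordMap_f_mem_I w hz

lemma image_Λ_sub_subset {ω : F.Ω} {i : Fin F.M} (hi : ω [] i = true) :
    F.f i '' F.Λ (F.sub i ω) ⊆ F.Λ ω := by
  rintro _ ⟨y, hy, rfl⟩
  refine Set.mem_iInter₂.2 fun n hn => ?_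
  obtain ⟨n, rfl⟩ : ∃ k, n = k + 1 := ⟨n - 1, by omega⟩
  rcases Nat.eq_zero_or_pos n with rfl | hn'
  · exact Set.mem_iUnion₂.2 ⟨[i], cons_mem_retained.2 ⟨hi, by simp⟩, y, Λ_subset_I _ hy, rfl⟩
  · obtain ⟨w, hw, z, hz, rfl⟩ := Set.mem_iUnion₂.1 (Set.mem_iInter₂.1 hy n hn')
    exact Set.mem_iUnion₂.2 ⟨i :: w, cons_mem_retained.2 ⟨hi, hw⟩, z, hz, rfl⟩

lemma exists_Icc_subset_Λ_of_sub {ω : F.Ω} {i : Fin F.M} (hi : ω [] i = true)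
    (h : ∃ x y : ℝ, x < y ∧ Set.Icc x y ⊆ F.Λ (F.sub i ω)) :
    ∃ x y : ℝ, x < y ∧ Set.Icc x y ⊆ F.Λ ω := by
  obtain ⟨x, y, hxy, h⟩ := h
  have hL : (0 : ℝ) < F.L := by have := F.one_lt_L; positivity
  refine ⟨F.f i x, F.f i y, ?_, fun z hz => image_Λ_sub_subset hi
    ⟨(z - F.t i) * F.L, h ⟨?_, ?_⟩, ?_⟩⟩
  · unfold f
    gcongr
  · have := hz.1
    rw [f, ← le_sub_iff_add_le, div_le_iff₀ hL] at this
    exact this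
  · have := hz.2
    rw [f, ← sub_le_iff_le_add, le_div_iff₀ hL] at this
    exact this
  · rw [f]
    field_simp
    ring

lemma exists_Icc_subset_Λ_of_hereditary {G : Set F.Ω}
    (hG : ∀ ω ∈ G, ∃ x y : ℝ, x < y ∧ Set.Icc x y ⊆ F.Λ ω) {ω : F.Ω} (h : F.Hereditary G ω) :
    ∃ x y : ℝ, x < y ∧ Set.Icc x y ⊆ F.Λ ω := by
  induction h with
  | root h => exact hG _ h
  | child hi _ ih => exact exists_Icc_subset_Λ_of_sub hi ih

/-- A point that is well approximated by retained words of unbounded lengths is in `Λ`. -/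
lemma mem_Λ_of_tendsto {ω : F.Ω} {x : ℝ} {w : ℕ → List (Fin F.M)}
    (hw : ∀ k, w k ∈ F.retained ω (w k).length)
    (hlen : Tendsto (fun k => (w k).length) atTop atTop)
    (hx : Tendsto (fun k => wordMap F.f (w k) 0) atTop (nhds x)) : x ∈ F.Λ ω := by
  refine Set.mem_iInter₂.2 fun n _ => ?_
  have hclosed : IsClosed (⋃ v ∈ F.retained ω n, wordMap F.f v '' F.I) := by
    refine (finite_retained ω n).isClosed_biUnion fun v _ => ?_
    refine (IsCompact.image isCompact_Icc ?_).isClosed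
    rw [show wordMap F.f v = _ from funext (F.wordMap_f_eq v)]
    fun_prop
  refine hclosed.mem_of_tendsto hx ?_
  filter_upwards [hlen.eventually_ge_atTop n] with k hk
  refine Set.mem_iUnion₂.2 ⟨(w k).take n, take_mem_retained (hw k) hk,
    wordMap F.f ((w k).drop n) 0, F.wordMap_f_mem_I _ F.zero_mem_I, ?_⟩
  rw [← wordMap_append, List.take_append_drop]

end Geometry

/-! ### Words aligned with `L`-adic parts of a basic type -/

section Types

/-- The left endpoint of the basic type `J^k`, divided by `L`. -/
noncomputable def offset (k : Fin F.N) : ℤ := F.typeIndex k - 1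

lemma offset_injective : Function.Injective F.offset := fun _ _ h =>
  (F.types.orderEmbOfFin rfl).injective (sub_left_injective h)

/-- The indices `i` with `f_i(J^k) = J^ℓ_a`. -/
noncomputable def branch (a : Fin F.L) (l k : Fin F.N) : Finset (Fin F.M) :=
  Finset.univ.filter fun i => F.offset k + F.t i = F.offset l * F.L + (a : ℕ)

lemma mem_branch {a : Fin F.L} {l k : Fin F.N} {i : Fin F.M} :
    i ∈ F.branch a l k ↔ F.offset k + F.t i = F.offset l * F.L + (a : ℕ) := by
  simp [branch]

lemma image_S_Icc (j : Fin F.m) (x y : ℝ) :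
    F.S j '' Set.Icc x y = Set.Icc (F.S j x) (F.S j y) := by
  have hL : (0 : ℝ) < F.L := by have := F.one_lt_L; positivity
  ext z
  constructor
  · rintro ⟨u, ⟨h1, h2⟩, rfl⟩
    constructor <;> unfold S <;> gcongr
  · rintro ⟨h1, h2⟩
    refine ⟨(z - F.τ j) * F.L, ⟨?_, ?_⟩, ?_⟩
    · rw [S, ← le_sub_iff_add_le, div_le_iff₀ hL] at h1
      exact h1
    · rw [S, ← sub_le_iff_le_add, le_div_iff₀ hL] at h2
      exact h2
    · rw [S]
      field_simp
      ring

lemma image_S_J_eq_Jsub_iff {j : Fin F.m} {a : Fin F.L} {l k : Fin F.N} :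
    F.S j '' F.J k = F.Jsub l a ↔ F.offset k + F.τ j = F.offset l * F.L + (a : ℕ) := by
  have hL : (0 : ℝ) < F.L := by have := F.one_lt_L; positivity
  have h1 : F.S j (((F.typeIndex k : ℝ) - 1) * F.L) = (F.offset k + F.τ j : ℤ) := by
    rw [S, offset]
    field_simp
    push_cast
    ring
  have h2 : F.S j ((F.typeIndex k : ℝ) * F.L) = (F.offset k + F.τ j : ℤ) + 1 := by
    rw [S, offset]
    field_simp
    push_cast
    ring
  have h3 : ((F.typeIndex l : ℝ) - 1) * F.L + (a : ℕ) = (F.offset l * F.L + (a : ℕ) : ℤ) := by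
    rw [offset]
    push_cast
    ring
  rw [J, lInterval, image_S_Icc, Jsub, h1, h2, h3]
  constructor
  · intro h
    have h4 := congrArg sInf h
    rw [csInf_Icc (by linarith), csInf_Icc (by linarith)] at h4
    exact_mod_cast h4
  · intro h
    rw [h]

/-- The matrix entry counts the repetitions of one map, and the alignment equation determines its
translation. -/
lemma A_eq_card_branch (a : Fin F.L) (l k : Fin F.N) : F.A a l k = (F.branch a l k).card := by
  unfold A
  split_ifs with h
  · have h1 := F.image_S_J_eq_Jsub_iff.1 h.choose_spec
    rw [n, branch]
    congr 1
    refine Finset.filter_congr fun i _ => ?_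
    omega
  · symm
    rw [Finset.card_eq_zero, Finset.eq_empty_iff_forall_notMem]
    intro i hi
    obtain ⟨j, hj, -⟩ := F.existsUnique_τ i
    exact h ⟨j, F.image_S_J_eq_Jsub_iff.2 (by rw [hj]; exact F.mem_branch.1 hi)⟩

lemma branch_disjoint {a : Fin F.L} {l l' k : Fin F.N} (h : l ≠ l') :
    Disjoint (F.branch a l k) (F.branch a l' k) := by
  refine Finset.disjoint_left.2 fun i hi hi' => h (F.offset_injective ?_)
  have hL : (F.L : ℤ) ≠ 0 := by have := F.two_le_L; omega
  rw [mem_branch] at hi hi'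
  exact mul_right_cancel₀ hL (by linarith)

lemma CS_le_M (a : Fin F.L) (k : Fin F.N) : F.CS a k ≤ F.M := by
  classical
  simp_rw [CS, A_eq_card_branch]
  rw [← Finset.card_biUnion fun l _ l' _ h => F.branch_disjoint h]
  simpa using Finset.card_le_univ (Finset.univ.biUnion fun l => F.branch a l k)

/-- The pairs `(w, i)` such that `w i` is aligned with the `a`-th part of a target with which `w`
is aligned. -/
noncomputable def candidates (Z : Fin F.N → Finset (List (Fin F.M))) (a : Fin F.L) (V : Fin F.N) :
    Finset (List (Fin F.M) × Fin F.M) := by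
  classical
  exact Finset.univ.biUnion fun k => Z k ×ˢ F.branch a k V

variable {F} in
lemma mem_candidates {Z : Fin F.N → Finset (List (Fin F.M))} {a : Fin F.L} {V : Fin F.N}
    {x : List (Fin F.M) × Fin F.M} :
    x ∈ F.candidates Z a V ↔ ∃ k, x.1 ∈ Z k ∧ x.2 ∈ F.branch a k V := by
  simp [candidates]

lemma card_candidates (Z : Fin F.N → Finset (List (Fin F.M))) (a : Fin F.L) (V : Fin F.N) :
    (F.candidates Z a V).card = ∑ k, (Z k).card * F.A a k V := by
  classical
  rw [candidates, Finset.card_biUnion]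
  · simp_rw [Finset.card_product, A_eq_card_branch]
  · intro k _ k' _ h
    exact Finset.disjoint_product.2 (Or.inr (F.branch_disjoint h))

/-- The retained words `w` of length `|c|` such that `f_w(J^V)` is the part of `J^U` with address
`c` (last digit first), along a chain of basic types. -/
noncomputable def aligned (ω : F.Ω) (U : Fin F.N) :
    List (Fin F.L) → Fin F.N → Finset (List (Fin F.M))
  | [], V => by
      classical
      exact if V = U then {[]} else ∅
  | a :: c, V => by
      classical
      exact ((F.candidates (aligned ω U c) a V).filter fun x => ω x.1 x.2 = true).image
        fun x => x.1 ++ [x.2]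

variable {F}

lemma mem_aligned_nil {ω : F.Ω} {U V : Fin F.N} {w : List (Fin F.M)} :
    w ∈ F.aligned ω U [] V ↔ V = U ∧ w = [] := by
  rw [aligned]
  split_ifs with h <;> simp [h]

lemma mem_aligned_cons {ω : F.Ω} {U V : Fin F.N} {a : Fin F.L} {c : List (Fin F.L)}
    {w : List (Fin F.M)} :
    w ∈ F.aligned ω U (a :: c) V ↔ ∃ k, ∃ u ∈ F.aligned ω U c k, ∃ i ∈ F.branch a k V,
      ω u i = true ∧ u ++ [i] = w := by
  rw [aligned]
  simp only [Finset.mem_image, Finset.mem_filter, mem_candidates, Prod.exists]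
  constructor
  · rintro ⟨u, i, ⟨⟨k, h1, h2⟩, h3⟩, h4⟩
    exact ⟨k, u, h1, i, h2, h3, h4⟩
  · rintro ⟨k, u, h1, i, h2, h3, h4⟩
    exact ⟨u, i, ⟨⟨k, h1, h2⟩, h3⟩, h4⟩

lemma card_aligned_cons (ω : F.Ω) (U V : Fin F.N) (a : Fin F.L) (c : List (Fin F.L)) :
    (F.aligned ω U (a :: c) V).card =
      ((F.candidates (F.aligned ω U c) a V).filter fun x => ω x.1 x.2 = true).card := by
  rw [aligned]
  refine Finset.card_image_of_injective _ ?_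
  rintro ⟨u, i⟩ ⟨u', i'⟩ h
  have := List.append_inj' h rfl
  simp_all

lemma mem_retained_of_mem_aligned {ω : F.Ω} {U V : Fin F.N} {c : List (Fin F.L)}
    {w : List (Fin F.M)} (h : w ∈ F.aligned ω U c V) : w ∈ F.retained ω c.length := by
  induction c generalizing V w with
  | nil => simpa using (mem_aligned_nil.1 h).2
  | cons a c ih =>
    obtain ⟨k, u, hu, i, -, hi, rfl⟩ := mem_aligned_cons.1 h
    exact append_singleton_mem_retained (ih hu) hi

lemma dependsOn_aligned (U : Fin F.N) (c : List (Fin F.L)) :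
    DependsOn (fun ω : F.Ω => F.aligned ω U c)
      (F.below c.length : Set (List (Fin F.M))) := by
  intro ω ω' h
  induction c with
  | nil => rfl
  | cons a c ih =>
    have ih' := ih fun w hw => h w (F.coe_below_mono (Nat.le_succ _) hw)
    simp only at ih' ⊢
    funext V
    ext w
    rw [mem_aligned_cons, mem_aligned_cons, ih']
    refine exists_congr fun k => exists_congr fun u => and_congr_right fun hu =>
      exists_congr fun i => and_congr_right fun _ => ?_
    rw [h u]
    rw [Finset.mem_coe, mem_below, (mem_retained_of_mem_aligned hu).1]
    simp

variable (F)

/-- The position of the part of `J^U` with address `c` (last digit first), in units of its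
length. -/
noncomputable def pos (U : Fin F.N) : List (Fin F.L) → ℤ
  | [] => F.offset U
  | a :: c => pos U c * F.L + (a : ℕ)

variable {F}

/-- Each `branch` equation makes the next map send the left end of `J^V` to the left end of the
`a`-th part of `J^k`, so the position depends on the address alone. -/
lemma wordMap_of_mem_aligned {ω : F.Ω} {U V : Fin F.N} {c : List (Fin F.L)}
    {w : List (Fin F.M)} (h : w ∈ F.aligned ω U c V) :
    wordMap F.f w (F.offset V * F.L) = F.pos U c * F.L / (F.L : ℝ) ^ c.length := by
  have hL : (F.L : ℝ) ≠ 0 := by have := F.one_lt_L; positivity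
  induction c generalizing V w with
  | nil =>
    obtain ⟨rfl, rfl⟩ := mem_aligned_nil.1 h
    simp [wordMap, pos]
  | cons a c ih =>
    obtain ⟨k, u, hu, i, hb, hi, rfl⟩ := mem_aligned_cons.1 h
    have h1 : (F.offset V : ℝ) + F.t i = F.offset k * F.L + (a : ℕ) := by
      exact_mod_cast F.mem_branch.1 hb
    have h2 : wordMap F.f [i] (F.offset V * F.L) = F.offset k * F.L + (a : ℕ) := by
      rw [← h1]
      simp [wordMap, f, hL]
    have h3 := ih hu
    rw [wordMap_f_eq, (mem_retained_of_mem_aligned hu).1] at h3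
    rw [wordMap_append, h2, wordMap_f_eq, (mem_retained_of_mem_aligned hu).1, pos,
      List.length_cons, eq_sub_of_add_eq' h3]
    push_cast
    field_simp
    ring

lemma exists_digit {U : Fin F.N} {c : List (Fin F.L)} {x : ℝ}
    (hx : ⌊x * (F.L : ℝ) ^ c.length / F.L⌋ = F.pos U c) :
    ∃ a : Fin F.L, ⌊x * (F.L : ℝ) ^ (a :: c).length / F.L⌋ = F.pos U (a :: c) := by
  have hL : (0 : ℝ) < F.L := by have := F.one_lt_L; positivity
  set y := x * (F.L : ℝ) ^ c.length / F.L with hy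
  have hy' : ∀ a : Fin F.L, x * (F.L : ℝ) ^ (a :: c).length / F.L = y * F.L := by
    intro a
    rw [hy, List.length_cons, pow_succ]
    ring
  obtain ⟨h1, h2⟩ := Int.floor_eq_iff.1 hx
  have h3 : F.pos U c * F.L ≤ ⌊y * F.L⌋ := by
    rw [Int.le_floor]
    push_cast
    gcongr
  have h4 : ⌊y * F.L⌋ < F.pos U c * F.L + F.L := by
    rw [Int.floor_lt]
    push_cast
    nlinarith
  refine ⟨⟨(⌊y * F.L⌋ - F.pos U c * F.L).toNat, by omega⟩, ?_⟩
  rw [hy', pos]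
  simp only [Int.ofNat_toNat]
  omega

end Types

/-! ### From aligned words at every address to an interval -/

section Interval

variable {F}

lemma exists_address {U : Fin F.N} {c : List (Fin F.L)} {x : ℝ}
    (hx : ⌊x * (F.L : ℝ) ^ c.length / F.L⌋ = F.pos U c) (n : ℕ) :
    ∃ d : List (Fin F.L), d.length = n ∧
      ⌊x * (F.L : ℝ) ^ (d ++ c).length / F.L⌋ = F.pos U (d ++ c) := by
  induction n with
  | zero => exact ⟨[], rfl, hx⟩
  | succ n ih =>
    obtain ⟨d, hd, h⟩ := ih
    obtain ⟨a, ha⟩ := exists_digit h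
    exact ⟨a :: d, by simp [hd], ha⟩

/-- Expand a point of the part in base `L`: each longer address carries an aligned retained word,
and these words approximate the point. -/
lemma exists_Icc_subset_Λ_of_aligned {ω : F.Ω} {U : Fin F.N} {c : List (Fin F.L)}
    (h : ∀ d V, (F.aligned ω U (d ++ c) V).Nonempty) :
    ∃ x y : ℝ, x < y ∧ Set.Icc x y ⊆ F.Λ ω := by
  have hL1 := F.one_lt_L
  have hL : (0 : ℝ) < F.L := by positivity
  -- Taking half of the part keeps away from its right end, where the floor would jump to the next
  -- address.
  refine ⟨F.pos U c * F.L / F.L ^ c.length, (F.pos U c + 1 / 2) * F.L / F.L ^ c.length, ?_, ?_⟩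
  · gcongr
    linarith
  rintro x ⟨hx1, hx2⟩
  have hx : ⌊x * (F.L : ℝ) ^ c.length / F.L⌋ = F.pos U c := by
    rw [div_le_iff₀ (by positivity)] at hx1
    rw [le_div_iff₀ (by positivity)] at hx2
    rw [Int.floor_eq_iff, le_div_iff₀ hL, div_lt_iff₀ hL]
    exact ⟨hx1, by nlinarith⟩
  choose d hd hdx using exists_address hx
  choose w hw using fun k => h (d k) U
  have hlen : ∀ k, (w k).length = k + c.length := by
    intro k
    rw [(mem_retained_of_mem_aligned (hw k)).1, List.length_append, hd]
  refine mem_Λ_of_tendsto (w := w) (fun k => ?_) ?_ ?_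
  · rw [(mem_retained_of_mem_aligned (hw k)).1]
    exact mem_retained_of_mem_aligned (hw k)
  · simp_rw [hlen]
    exact tendsto_add_atTop_nat _
  -- At unit scale, `F.L` bounds the distance of the point from the left end of its part, and the
  -- other term pays for evaluating at `0` instead of the left end of `J^U`.
  · set R : ℝ := F.L + |F.offset U * (F.L : ℝ)| with hR
    have hbound : ∀ k, |wordMap F.f (w k) 0 - x| ≤ R * ((F.L : ℝ)⁻¹ ^ (k + c.length)) := by
      intro k
      have h1 := wordMap_of_mem_aligned (hw k)
      have hlen' : (d k ++ c).length = k + c.length := by rw [List.length_append, hd]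
      have h2 := hdx k
      rw [wordMap_f_eq, hlen, hlen'] at h1
      rw [hlen', Int.floor_eq_iff, le_div_iff₀ hL, div_lt_iff₀ hL] at h2
      set q : ℝ := (F.L : ℝ) ^ (k + c.length) with hq
      have hq0 : 0 < q := by positivity
      rw [eq_sub_of_add_eq' h1, inv_pow, ← hq, ← div_eq_mul_inv, le_div_iff₀ hq0,
        ← abs_of_pos hq0, ← abs_mul, abs_of_pos hq0, hR]
      have h3 : (F.pos U (d k ++ c) * F.L / q - F.offset U * (F.L : ℝ) / q - x) * q =
          (F.pos U (d k ++ c) * F.L - x * q) - F.offset U * (F.L : ℝ) := by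
        field_simp
        ring
      rw [h3]
      refine (abs_sub _ _).trans (add_le_add_left ?_ _)
      rw [abs_le]
      constructor <;> linarith [h2.1, h2.2]
    rw [tendsto_iff_dist_tendsto_zero]
    have hlim : Tendsto (fun k : ℕ => R * ((F.L : ℝ)⁻¹ ^ (k + c.length))) atTop (nhds 0) := by
      have := ((tendsto_pow_atTop_nhds_zero_of_lt_one (inv_nonneg.2 hL.le)
        (inv_lt_one_of_one_lt₀ hL1)).comp (tendsto_add_atTop_nat c.length)).const_mul R
      simpa using this
    exact squeeze_zero (fun k => dist_nonneg) (fun k => hbound k) hlim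

lemma mem_nonExtinction_of_aligned {ω : F.Ω} {U : Fin F.N} {c : List (Fin F.L)}
    (h : ∀ d V, (F.aligned ω U (d ++ c) V).Nonempty) : ω ∈ F.nonExtinction := by
  refine mem_nonExtinction_iff_forall_retained_nonempty.2 fun n => ?_
  obtain ⟨w, hw⟩ := h (List.replicate n ⟨0, by have := F.two_le_L; omega⟩) U
  have := mem_retained_of_mem_aligned hw
  exact ⟨_, take_mem_retained this (by simp)⟩

end Interval

/-! ### Exponential growth of the aligned words -/

section Growth

lemma summable_pow_mul_exp_neg (b K : ℝ) {κ θ : ℝ} (hb : 0 < b) (hK : 0 < K) (hκ : 0 < κ)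
    (hθ : 1 < θ) : Summable fun n : ℕ => b ^ n * K * Real.exp (-κ * θ ^ n) := by
  refine summable_of_ratio_test_tendsto_lt_one zero_lt_one (Eventually.of_forall fun n => ?_) ?_
  · positivity
  · have h1 : ∀ n : ℕ, ‖b ^ (n + 1) * K * Real.exp (-κ * θ ^ (n + 1))‖ /
        ‖b ^ n * K * Real.exp (-κ * θ ^ n)‖ = b * Real.exp (-(κ * (θ - 1) * θ ^ n)) := by
      intro n
      have h2 : Real.exp (-κ * θ ^ (n + 1)) =
          Real.exp (-κ * θ ^ n) * Real.exp (-(κ * (θ - 1) * θ ^ n)) := by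
        rw [← Real.exp_add]
        congr 1
        ring
      rw [Real.norm_of_nonneg (by positivity), Real.norm_of_nonneg (by positivity), h2]
      field_simp
      ring
    simp_rw [h1]
    have h3 : Tendsto (fun n : ℕ => κ * (θ - 1) * θ ^ n) atTop atTop :=
      (tendsto_pow_atTop_atTop_of_one_lt hθ).const_mul_atTop
        (mul_pos hκ (sub_pos.2 hθ))
    simpa using (Real.tendsto_exp_neg_atTop_nhds_zero.comp h3).const_mul b

/-- All coins of the words of length less than `n` show head. -/
def allHeads (n : ℕ) : Set F.Ω := {ω | ∀ w : List (Fin F.M), w.length < n → ∀ i, ω w i = true}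

lemma dependsOn_allHeads (n : ℕ) :
    DependsOn (· ∈ F.allHeads n) (F.below n : Set (List (Fin F.M))) := by
  intro ω ω' h
  simp only [allHeads, Set.mem_ofPred_eq, eq_iff_iff]
  refine forall_congr' fun w => forall_congr' fun hw => ?_
  rw [h w (by simpa using hw)]

lemma coinLaw_allHeads_pos {p : unitInterval} (hp : 0 < p) (n : ℕ) :
    0 < F.coinLaw p (F.allHeads n) := by
  have h : F.allHeads n = Set.pi (F.below n) fun _ => {fun _ => true} := by
    ext ω
    simp [allHeads, Set.mem_pi, funext_iff]
  rw [h, coinLaw, Measure.infinitePi_pi _ fun _ _ => MeasurableSet.of_discrete]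
  refine pos_iff_ne_zero.2 (Finset.prod_ne_zero_iff.2 fun w _ => ?_)
  rw [Measure.pi_singleton]
  refine Finset.prod_ne_zero_iff.2 fun i _ => ?_
  rw [bernoulliMeasure_apply_of_mem_of_notMem p MeasurableSet.of_discrete
    (Set.mem_singleton _) (by simp)]
  exact (ENNReal.coe_pos.2 (show 0 < unitInterval.toNNReal p from hp)).ne'

variable {F}

lemma card_aligned_cons_of_allHeads {ω : F.Ω} {n : ℕ} (hω : ω ∈ F.allHeads n) (U V : Fin F.N)
    (a : Fin F.L) {c : List (Fin F.L)} (hc : c.length < n) :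
    (F.aligned ω U (a :: c) V).card = ∑ k, (F.aligned ω U c k).card * F.A a k V := by
  rw [card_aligned_cons, ← card_candidates, Finset.filter_true_of_mem]
  intro x hx
  obtain ⟨k, hk, -⟩ := mem_candidates.1 hx
  exact hω _ (by rwa [(mem_retained_of_mem_aligned hk).1]) _

lemma card_aligned_of_allHeads {ω : F.Ω} {n : ℕ} (hω : ω ∈ F.allHeads n) (U V : Fin F.N)
    {c : List (Fin F.L)} (hc : c.length ≤ n) :
    (F.aligned ω U c V).card = F.Aword c.reverse U V := by
  induction c generalizing V with
  | nil =>
    rw [aligned, Aword]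
    simp only [List.reverse_nil, List.map_nil, List.prod_nil, Matrix.one_apply]
    by_cases h : V = U
    · simp [h]
    · simp [h, Ne.symm h]
  | cons a c ih =>
    have hc' : c.length < n := hc
    rw [card_aligned_cons_of_allHeads hω U V a hc', Aword, List.reverse_cons, List.map_append,
      List.prod_append, List.map_singleton, List.prod_singleton, Matrix.mul_apply]
    exact Finset.sum_congr rfl fun k _ => by rw [ih k hc'.le]; rfl

/-- Column sums enter because a word of the new type `V` may extend a word of any type `k`, and all
types have at least `K` words. -/
lemma mul_CS_le_card_candidates {Z : Fin F.N → Finset (List (Fin F.M))} {K : ℝ}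
    (hZ : ∀ k, K ≤ (Z k).card) (a : Fin F.L) (V : Fin F.N) :
    K * F.CS a V ≤ (F.candidates Z a V).card := by
  rw [card_candidates, CS]
  push_cast
  rw [Finset.mul_sum]
  exact Finset.sum_le_sum fun k _ => mul_le_mul_of_nonneg_right (hZ k) (Nat.cast_nonneg _)

variable (F) in
/-- The event that all parts of generation `n` of the part of `J^U` with address `c` are aligned
with at least `θ ^ n` retained words of each type. -/
def abundant (U : Fin F.N) (c : List (Fin F.L)) (θ : ℝ) (n : ℕ) : Set F.Ω :=
  {ω | ∀ d : List (Fin F.L), d.length = n → ∀ V, θ ^ n ≤ ((F.aligned ω U (d ++ c) V).card : ℝ)}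

lemma dependsOn_abundant (U : Fin F.N) (c : List (Fin F.L)) (θ : ℝ) (n : ℕ) :
    DependsOn (· ∈ F.abundant U c θ n) (F.below (c.length + n) : Set (List (Fin F.M))) := by
  intro ω ω' h
  simp only [abundant, Set.mem_ofPred_eq, eq_iff_iff]
  refine forall_congr' fun d => forall_congr' fun hd => ?_
  have := dependsOn_aligned U (d ++ c) (x := ω) (y := ω') fun w hw => h w (by
    simp only [Finset.mem_coe, mem_below, List.length_append] at hw ⊢
    omega)
  simp only at this
  rw [this]

variable {p : unitInterval} {θ : ℝ}

/-- With all heads nothing is lost, so each generation multiplies the counts by at least `CS a V ≥ θ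
^ 2 ≥ θ`. The positive row gives the count `1` at the start. -/
lemma allHeads_subset_abundant (hθ : 1 ≤ θ) (hCS : ∀ a V, θ ^ 2 ≤ p * F.CS a V) {U : Fin F.N}
    {c : List (Fin F.L)} (hc : ∀ V, 0 < F.Aword c.reverse U V) {n m : ℕ} (hm : m ≤ n) :
    F.allHeads (c.length + n) ⊆ F.abundant U c θ m := by
  intro ω hω
  induction m with
  | zero =>
    intro d hd V
    rw [List.length_eq_zero_iff.1 hd, List.nil_append,
      card_aligned_of_allHeads hω U V (Nat.le_add_right _ _), pow_zero]
    exact_mod_cast hc V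
  | succ m ih =>
    intro d hd V
    obtain ⟨a, d, rfl⟩ := List.exists_cons_of_length_eq_add_one hd
    have hd' : d.length = m := by simpa using hd
    rw [List.cons_append, card_aligned_cons_of_allHeads hω U V a
      (by rw [List.length_append]; omega), ← card_candidates]
    refine le_trans ?_ (mul_CS_le_card_candidates (ih (by omega) d hd') a V)
    rw [pow_succ]
    have h1 : (p : ℝ) * F.CS a V ≤ F.CS a V := mul_le_of_le_one_left (Nat.cast_nonneg _) p.2.2
    have h2 := hCS a V
    gcongr
    nlinarith

lemma coinLaw_allHeads_inter_abundant_diff_le (hp : 0 < p) (hθ : 1 < θ)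
    (hCS : ∀ a V, θ ^ 2 ≤ p * F.CS a V) (U : Fin F.N) (c : List (Fin F.L)) {n m : ℕ}
    (hm : n ≤ m) :
    F.coinLaw p ((F.allHeads (c.length + n) ∩ F.abundant U c θ m) \ F.abundant U c θ (m + 1)) ≤
      F.coinLaw p (F.allHeads (c.length + n)) * ENNReal.ofReal
        ((F.L : ℝ) ^ m * (F.L * F.N) * Real.exp (-(2 * (p * (1 - θ⁻¹)) ^ 2) * θ ^ m)) := by
  have hp' : (0 : ℝ) < p := hp
  have hθ0 : (0 : ℝ) < θ := by linarith
  have hη : 0 ≤ (p : ℝ) * (1 - θ⁻¹) :=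
    mul_nonneg hp'.le (sub_nonneg.2 (inv_le_one_of_one_le₀ hθ.le))
  -- With this deviation `p - η = p / θ`: of the growth factor `θ ^ 2` one factor `θ` is given up to
  -- concentration and one remains.
  set η : ℝ := p * (1 - θ⁻¹) with hη_def
  set D := F.allHeads (c.length + n) ∩ F.abundant U c θ m with hD_def
  have hD : DependsOn (· ∈ D) (F.below (c.length + m) : Set (List (Fin F.M))) := by
    intro ω ω' h
    have h1 : (ω ∈ F.allHeads (c.length + n)) = (ω' ∈ F.allHeads (c.length + n)) :=
      F.dependsOn_allHeads _ fun w hw => h w (F.coe_below_mono (by omega) hw)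
    have h2 : (ω ∈ F.abundant U c θ m) = (ω' ∈ F.abundant U c θ m) := dependsOn_abundant _ _ _ _ h
    simp only [hD_def, Set.mem_inter_iff, h1, h2]
  -- The union bound runs over the address of the parent part, the next digit and the new type,
  -- hence the factor `L ^ m * (L * N)`.
  let C : (Fin m → Fin F.L) × Fin F.L × Fin F.N → F.Ω → Finset (List (Fin F.M) × Fin F.M) :=
    fun x ω => F.candidates (F.aligned ω U (List.ofFn x.1 ++ c)) x.2.1 x.2.2
  have hlen : ∀ x, (List.ofFn (n := m) x ++ c : List (Fin F.L)).length = c.length + m := by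
    intro x
    rw [List.length_append, List.length_ofFn, add_comm]
  have hstep : ∀ x, F.coinLaw p (D ∩ {ω | (((C x ω).filter fun c => ω c.1 c.2 = true).card : ℝ) ≤
      (p - η) * (C x ω).card}) ≤ F.coinLaw p (F.allHeads (c.length + n)) *
        ENNReal.ofReal (Real.exp (-(2 * η ^ 2) * θ ^ m)) := by
    intro x
    refine (F.coinLaw_card_heads_random_le p hD (C := C x) ?_ ?_ hη (K := θ ^ m) ?_).trans ?_
    · intro ω ω' h
      have := dependsOn_aligned U (List.ofFn x.1 ++ c) (x := ω) (y := ω') (by rwa [hlen])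
      simp only at this
      simp only [C, this]
    · intro ω y hy
      obtain ⟨k, hk, -⟩ := mem_candidates.1 hy
      rw [(mem_retained_of_mem_aligned hk).1, hlen]
    · rintro ω ⟨-, hω⟩
      refine le_trans ?_ (mul_CS_le_card_candidates (hω _ (List.length_ofFn)) x.2.1 x.2.2)
      have h1 : (p : ℝ) * F.CS x.2.1 x.2.2 ≤ F.CS x.2.1 x.2.2 :=
        mul_le_of_le_one_left (Nat.cast_nonneg _) p.2.2
      have h2 := hCS x.2.1 x.2.2
      refine le_mul_of_one_le_right (by positivity) ?_
      nlinarith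
    · gcongr
      exact Set.inter_subset_left
  refine (measure_mono (t := ⋃ x, D ∩ {ω | (((C x ω).filter fun c => ω c.1 c.2 = true).card : ℝ) ≤
      (p - η) * (C x ω).card}) ?_).trans ((measure_iUnion_fintype_le _ _).trans
      ((Finset.sum_le_sum fun x _ => hstep x).trans_eq ?_))
  · rintro ω ⟨hω, hω'⟩
    simp only [abundant, Set.mem_ofPred_eq, not_forall, not_le] at hω'
    obtain ⟨d, hd, V, hV⟩ := hω'
    obtain ⟨a, d, rfl⟩ := List.exists_cons_of_length_eq_add_one hd
    obtain rfl : d.length = m := by simpa using hd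
    refine Set.mem_iUnion.2 ⟨(d.get, a, V), hω, ?_⟩
    have hCd : C (d.get, a, V) ω = F.candidates (F.aligned ω U (d ++ c)) a V := by
      simp only [C, List.ofFn_get]
    rw [Set.mem_ofPred_eq, hCd, ← card_aligned_cons]
    refine hV.le.trans ?_
    have h1 := mul_CS_le_card_candidates (hω.2 d rfl) a V
    have h2 : (p : ℝ) - η = p / θ := by
      rw [hη_def]
      field_simp
      ring
    rw [h2]
    calc θ ^ (d.length + 1) = θ ^ d.length * θ ^ 2 / θ := by
          field_simp
          ring
      _ ≤ θ ^ d.length * (p * F.CS a V) / θ := by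
        have := hCS a V
        gcongr
      _ = p / θ * (θ ^ d.length * F.CS a V) := by ring
      _ ≤ _ := by gcongr
  · rw [Finset.sum_const, Finset.card_univ, nsmul_eq_mul, ENNReal.ofReal_mul (by positivity)]
    rw [show ((F.L : ℝ) ^ m * (F.L * F.N)) = ((F.L ^ m * (F.L * F.N) : ℕ) : ℝ) by push_cast; rfl,
      ENNReal.ofReal_natCast]
    simp only [Fintype.card_prod, Fintype.card_fun, Fintype.card_fin]
    ring

lemma coinLaw_iInter_abundant_pos (hp : 0 < p) (hθ : 1 < θ)
    (hCS : ∀ a V, θ ^ 2 ≤ p * F.CS a V) {U : Fin F.N} {c : List (Fin F.L)}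
    (hc : ∀ V, 0 < F.Aword c.reverse U V) :
    0 < F.coinLaw p (⋂ n, F.abundant U c θ n) := by
  have hp' : (0 : ℝ) < p := hp
  have hL : (0 : ℝ) < F.L := by have := F.one_lt_L; positivity
  have hN : (0 : ℝ) < F.N := by exact_mod_cast U.pos
  have hη : 0 < 1 - θ⁻¹ := sub_pos.2 (inv_lt_one_of_one_lt₀ hθ)
  set κ : ℝ := 2 * (p * (1 - θ⁻¹)) ^ 2 with hκ
  set u : ℕ → ℝ := fun m => (F.L : ℝ) ^ m * (F.L * F.N) * Real.exp (-κ * θ ^ m) with hu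
  have hu0 : ∀ m, 0 ≤ u m := fun m => by positivity
  have hsum : Summable u :=
    summable_pow_mul_exp_neg _ _ hL (by positivity) (by positivity) hθ
  -- Heads are forced up to a generation beyond which the failure bounds sum to less than `1`. Each
  -- bound carries the factor `P H`, so the failures cannot exhaust `H`, however small `P H` is.
  obtain ⟨n, hn⟩ := ((tendsto_sum_nat_add u).eventually_lt_const zero_lt_one).exists
  set H := F.allHeads (c.length + n) with hH
  have hHpos : 0 < F.coinLaw p H := F.coinLaw_allHeads_pos hp _
  by_contra hcon
  have hzero : F.coinLaw p (⋂ n, F.abundant U c θ n) = 0 := by simpa using hcon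
  have hcover : H ⊆ (⋂ n, F.abundant U c θ n) ∪
      ⋃ m, ((H ∩ F.abundant U c θ (m + n)) \ F.abundant U c θ (m + n + 1)) := by
    intro ω hω
    by_contra h
    simp only [Set.mem_union, Set.mem_iInter, Set.mem_iUnion, Set.mem_sdiff, Set.mem_inter_iff,
      not_or, not_exists, not_and, not_not] at h
    refine h.1 fun m => ?_
    rcases le_total m n with hm | hm
    · exact allHeads_subset_abundant hθ.le hCS hc hm hω
    · obtain ⟨k, rfl⟩ := Nat.exists_eq_add_of_le' hm
      clear hm
      induction k with
      | zero => exact allHeads_subset_abundant hθ.le hCS hc (by omega) hω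
      | succ k ih =>
        have := h.2 k ⟨hω, ih⟩
        rwa [show k + 1 + n = k + n + 1 by omega]
  have hle : F.coinLaw p H ≤ F.coinLaw p H * ENNReal.ofReal (∑' m, u (m + n)) := by
    refine (measure_mono hcover).trans ((measure_union_le _ _).trans ?_)
    rw [hzero, zero_add, ENNReal.ofReal_tsum_of_nonneg (fun m => hu0 _)
      ((summable_nat_add_iff n).2 hsum), ← ENNReal.tsum_mul_left]
    refine (measure_iUnion_le _).trans (ENNReal.tsum_le_tsum fun m => ?_)
    exact coinLaw_allHeads_inter_abundant_diff_le hp hθ hCS U c (Nat.le_add_left n m)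
  refine absurd hle (not_le.2 ?_)
  calc _ < F.coinLaw p H * 1 := by
        refine ENNReal.mul_lt_mul_right hHpos.ne' (measure_ne_top _ _) ?_
        rwa [ENNReal.ofReal_lt_one]
    _ = _ := mul_one _

end Growth

end IntegerIFS

theorem theoremy26 (F : IntegerIFS) (p : ℝ) (hp : p ∈ Set.Ioo (0 : ℝ) 1)
    (hCS : ∀ (a : Fin F.L) (U : Fin F.N), 1 < p * F.CS a U)
    (hrow : ∃ (b : List (Fin F.L)) (U : Fin F.N), ∀ V : Fin F.N, 0 < F.Aword b U V) :
    0 < F.coinLaw ⟨p, Set.Ioo_subset_Icc_self hp⟩ F.nonExtinction ∧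
      ∀ᵐ ω ∂(cond (F.coinLaw ⟨p, Set.Ioo_subset_Icc_self hp⟩) F.nonExtinction),
        ∃ x y : ℝ, x < y ∧ Set.Icc x y ⊆ F.Λ ω := by
  obtain ⟨b, U, hb⟩ := hrow
  set P : unitInterval := ⟨p, Set.Ioo_subset_Icc_self hp⟩ with hP
  have hP0 : 0 < P := hp.1
  have a₀ : Fin F.L := ⟨0, by have := F.two_le_L; omega⟩
  have : Nonempty (Fin F.L × Fin F.N) := ⟨(a₀, U)⟩
  -- There are finitely many column sums, so their strict bounds yield one uniform `θ > 1`.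
  obtain ⟨⟨a₁, U₁⟩, hmin⟩ := Finite.exists_min
    fun x : Fin F.L × Fin F.N => p * F.CS x.1 x.2
  set θ := Real.sqrt (p * F.CS a₁ U₁)
  have hθ : 1 < θ := Real.lt_sqrt_of_sq_lt (by simpa using hCS a₁ U₁)
  have hθCS : ∀ a V, θ ^ 2 ≤ (P : ℝ) * F.CS a V := by
    intro a V
    rw [Real.sq_sqrt (by linarith [hCS a₁ U₁])]
    exact hmin (a, V)
  -- The zero-one law uses strict convexity, which fails for a single child. Here `1 < p * CS ≤ p *
  -- M` with `p < 1` rules that out.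
  have hM : 2 ≤ F.M := by
    have h1 : (F.CS a₀ U : ℝ) ≤ F.M := by exact_mod_cast F.CS_le_M a₀ U
    have h2 := hCS a₀ U
    have h3 : (1 : ℝ) < F.M := by nlinarith [hp.1, hp.2]
    exact_mod_cast h3
  -- Addresses list the last digit first, so the word `b` is reversed.
  set G : Set F.Ω := ⋂ n, F.abundant U b.reverse θ n with hG
  have hGpos : 0 < F.coinLaw P G :=
    IntegerIFS.coinLaw_iInter_abundant_pos hP0 hθ hθCS (by simpa using hb)
  have hGm : MeasurableSet G := MeasurableSet.iInter fun n =>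
    F.measurableSet_of_dependsOn (IntegerIFS.dependsOn_abundant _ _ _ _)
  have hGal : ∀ ω ∈ G, ∀ d V, (F.aligned ω U (d ++ b.reverse) V).Nonempty := by
    intro ω hω d V
    rw [← Finset.card_pos]
    have h1 := Set.mem_iInter.1 hω d.length d rfl V
    have h2 : (0 : ℝ) < θ ^ d.length := by positivity
    exact_mod_cast h2.trans_le h1
  have hGne : G ⊆ F.nonExtinction := fun ω hω =>
    IntegerIFS.mem_nonExtinction_of_aligned (hGal ω hω)
  refine ⟨hGpos.trans_le (measure_mono hGne), ?_⟩
  have hnull := F.coinLaw_nonExtinction_diff_hereditary hM P hP0 hGm hGne hGpos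
  rw [ae_iff, cond_apply F.measurableSet_nonExtinction]
  refine mul_eq_zero_of_right _ (measure_mono_null ?_ hnull)
  rintro ω ⟨h1, h2⟩
  exact ⟨h1, fun h => h2 (IntegerIFS.exists_Icc_subset_Λ_of_hereditary
    (fun ω hω => IntegerIFS.exists_Icc_subset_Λ_of_aligned (hGal ω hω)) h)⟩
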